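/- Let $R$ be a commutative ring and let $\mathcal P$ be a symmetric operad in $R$-modules: a sequence of $R$-modules $\mathcal P(n)$, $n\ge 0$, with right $R$-linear actions of the symmetric groups $\Sigma(n)$, a unit $1_{\mathcal P}\in\mathcal P(1)$ and partial compositions $\circ_i:\mathcal P(m)\otimes\mathcal P(n)\to\mathcal P(m+n-1)$, $1\le i\le m$, satisfying the usual unit, associativity and equivariance axioms. Let $\mathsf{ALG}_{\mathcal P}$ be the category of $\mathcal P$-algebras, i.e. $R$-modules $A$ with $R$-multilinear operations $(a_1,\dots,a_n)\mapsto\mu(a_1,\dots,a_n)$, $\mu\in\mathcal P(n)$, linear in $\mu$ and compatible with the unit, the symmetric group actions and the compositions. For a $\mathcal P$-algebra $A$: - The semi-direct product $A\ltimes A$ is the $R$-module $A\times A$ with the operations $\mu((a_1,b_1),\dots,(a_n,b_n))=\bigl(\mu(a_1,\dots,a_n),\ \sum_{i=1}^n\mu(a_1,\dots,b_i,\dots,a_n)\bigr)$. Put $\mathsf T(A)=A\ltimes A$ and $\mathsf T(f)(a,b)=(f(a),f(b))$ for a morphism $f$. - An $A$-module is an $R$-module $M$ with linear maps $\mathcal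 P(n+1)\otimes A^{\otimes n}\otimes M\to M$, written $\mu(a_1,\dots,a_n,x)$, that are equivariant, unital and associative. An $A$-derivation $D:A\to M$ is an $R$-linear map with $D(\mu(a_1,\dots,a_n))=\sum_{i=1}^n\mu(a_1,\dots,D(a_i),\dots,a_n)$. The module of Kähler differentials $\Omega_A$ is the $A$-module with the universal derivation $\mathsf d:A\to\Omega_A$. - An $A$-algebra is a $\mathcal P$-algebra $B$ with a morphism $u:A\to B$ of $\mathcal P$-algebras; it is an $A$-module through $\mu(a_1,\dots,a_n,b)=\mu(u(a_1),\dots,u(a_n),b)$. For an $A$-module $M$, $\mathsf{Free}_A(M)$ is the free $A$-algebra over $M$, i.e. the $A$-algebra with an $A$-module morphism $M\to\mathsf{Free}_A(M)$ that is universal among $A$-module morphisms from $M$ to $A$-algebras. Put $\mathsf T^\circ(A)=\mathsf{Free}_A(\Omega_A)$. It is generated as a $\mathcal P$-algebra by the images, written $a$ and $\mathsf d(a)$, of the elements $a\in A$ and $\mathsf d(a)\in\Omega_A$. It is a functor through $\mathsf T^\circ(f)(a)=f(a)$ and $\mathsf T^\circ(f)(\mathsf d(a))=\mathsf d(f(a))$.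 **Lemma.** The functor $\mathsf T^\circ:\mathsf{ALG}_{\mathcal P}\to\mathsf{ALG}_{\mathcal P}$ is left adjoint to $\mathsf T:\mathsf{ALG}_{\mathcal P}\to\mathsf{ALG}_{\mathcal P}$. There is an adjunction $(\eta,\varepsilon):\mathsf T^\circ\dashv\mathsf T$ whose unit $\eta_A:A\to\mathsf T^\circ(A)\ltimes\mathsf T^\circ(A)$ is $\eta_A(a)=(a,\mathsf d(a))$ and whose counit $\varepsilon_A:\mathsf T^\circ(A\ltimes A)\to A$ is given on generators by $\varepsilon_A((a,b))=a$ and $\varepsilon_A(\mathsf d(a,b))=b$. The corresponding natural bijection $\mathsf{ALG}_{\mathcal P}(\mathsf T^\circ(A),A')\cong\mathsf{ALG}_{\mathcal P}(A,A'\ltimes A')$ sends $f$ to $f^\flat$ with $f^\flat(a)=(f(a),f(\mathsf d(a)))$, and its inverse sends $g=(g_1,g_2)$ to $g^\sharp$ with $g^\sharp(a)=g_1(a)$ and $g^\sharp(\mathsf d(a))=g_2(a)$. -/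

import Mathlib

open CategoryTheory

universe u

/-! ## Symmetric operads in `R`-modules, through partial compositions -/

section Positions

variable {m n k : ℕ}

/-- When an operation with `n` inputs is plugged into input `i` of an operation with `m` inputs,
its input `t` becomes this input of the composite. Inputs are numbered from `0`. -/
def innerPos (h : m + n = k + 1) (i : Fin m) (t : Fin n) : Fin k :=
  ⟨i + t, by omega⟩

/-- When an operation with `n` inputs is plugged into input `i` of an operation with `m` inputs,
the other input `j ≠ i` of the latter becomes this input of the composite. -/
def outerPos (h : m + n = k + 1) (i : Fin m) (j : {j : Fin m // j ≠ i}) : Fin k :=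
  ⟨if (j : Fin m) < i then (j : ℕ) else (j : ℕ) + n - 1, by
    obtain ⟨j, hj⟩ := j
    have : (j : ℕ) ≠ i := fun e => hj (Fin.ext e)
    simp only [Fin.lt_def]
    split_ifs <;> omega⟩

theorem slots_bijective (h : m + n = k + 1) (i : Fin m) :
    Function.Bijective (Sum.elim (innerPos h i) (outerPos h i)) := by
  constructor
  · rintro (s | ⟨s, hs⟩) (t | ⟨t, ht⟩) e
    · simp only [Sum.elim_inl, innerPos, Fin.mk.injEq] at e
      congr 1; ext; omega
    · have : (t : ℕ) ≠ i := fun e => ht (Fin.ext e)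
      simp only [Sum.elim_inl, Sum.elim_inr, innerPos, outerPos, Fin.mk.injEq, Fin.lt_def] at e
      split_ifs at e <;> omega
    · have : (s : ℕ) ≠ i := fun e => hs (Fin.ext e)
      simp only [Sum.elim_inl, Sum.elim_inr, innerPos, outerPos, Fin.mk.injEq, Fin.lt_def] at e
      split_ifs at e <;> omega
    · have : (t : ℕ) ≠ i := fun e => ht (Fin.ext e)
      have : (s : ℕ) ≠ i := fun e => hs (Fin.ext e)
      simp only [Sum.elim_inr, outerPos, Fin.mk.injEq, Fin.lt_def] at e
      congr 2; ext
      split_ifs at e <;> omega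
  · intro s
    by_cases h1 : (s : ℕ) < i
    · refine ⟨Sum.inr ⟨⟨s, by omega⟩, fun e => ?_⟩, ?_⟩
      · have := congrArg Fin.val e; simp at this; omega
      · ext; simp [outerPos, Fin.lt_def, h1]
    · by_cases h2 : (s : ℕ) < i + n
      · refine ⟨Sum.inl ⟨s - i, by omega⟩, ?_⟩
        ext; simp [innerPos]; omega
      · refine ⟨Sum.inr ⟨⟨s + 1 - n, by omega⟩, fun e => ?_⟩, ?_⟩
        · have := congrArg Fin.val e; simp at this; omega
        · ext
          simp only [Sum.elim_inr, outerPos, Fin.lt_def]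
          split_ifs <;> omega

/-- The inputs of a composite `μ ∘ᵢ ν` are those of `ν` together with those of `μ` other
than `i`. -/
noncomputable def slots (h : m + n = k + 1) (i : Fin m) :
    Fin n ⊕ {j : Fin m // j ≠ i} ≃ Fin k :=
  Equiv.ofBijective _ (slots_bijective h i)

/-- The tuple `(a₁, …, aᵢ₋₁, f (aᵢ, …, aᵢ₊ₙ₋₁), aᵢ₊ₙ, …, aₖ)`, of length `m`. -/
def graft {X : Type*} (h : m + n = k + 1) (i : Fin m) (f : (Fin n → X) → X) (a : Fin k → X) :
    Fin m → X :=
  fun j => if hj : j = i then f (fun t => a (innerPos h i t)) else a (outerPos h i ⟨j, hj⟩)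

/-- A permutation `σ` of the inputs of `ν` induces this permutation of the inputs of
`μ ∘ᵢ ν`: it is `σ` on the inputs of `ν` and the identity on the others. -/
noncomputable def permInner (h : m + n = k + 1) (i : Fin m) (σ : Equiv.Perm (Fin n)) :
    Equiv.Perm (Fin k) :=
  (slots h i).symm.trans ((Equiv.sumCongr σ (Equiv.refl _)).trans (slots h i))

/-- A permutation `σ` of the inputs of `μ` induces this block permutation, which sends the
inputs of `(μ · σ) ∘ᵢ ν` to those of `μ ∘_{σ i} ν`. -/
noncomputable def permOuter (h : m + n = k + 1) (i : Fin m) (σ : Equiv.Perm (Fin m)) :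
    Equiv.Perm (Fin k) :=
  (slots h i).symm.trans
    ((Equiv.sumCongr (Equiv.refl _)
      (σ.subtypeEquiv (p := fun j => j ≠ i) (q := fun j => j ≠ σ i)
        (fun _ => σ.injective.ne_iff.symm))).trans (slots h (σ i)))

/-- A permutation of the first `n` of `n + 1` inputs, the last one being fixed. -/
def permInit (σ : Equiv.Perm (Fin n)) : Equiv.Perm (Fin (n + 1)) :=
  finSuccEquivLast.trans ((Equiv.optionCongr σ).trans finSuccEquivLast.symm)

/-- The cycle `(i i+1 … n)` of `{0, …, n}`: it sends `n` to `i`, and `{0, …, n-1}` to the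
complement of `i`, preserving the order. -/
def cycleLast (i : Fin (n + 1)) : Equiv.Perm (Fin (n + 1)) :=
  finSuccEquivLast.trans (finSuccEquiv' i).symm

end Positions

/-- A (symmetric, algebraic) operad over `R`. The partial composition `∘ᵢ` of operations with
`m` and `n` inputs has `m + n - 1` inputs; this number is given as a `k` with `m + n = k + 1`. -/
structure SymmOperad (R : Type u) [CommRing R] where
  obj : ℕ → Type u
  [addCommGroup : ∀ n, AddCommGroup (obj n)]
  [module : ∀ n, Module R (obj n)]
  /-- the distinguished element `1 ∈ P(1)` -/
  one : obj 1
  /-- the right action: `perm σ μ` is `μ · σ` -/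
  perm {n : ℕ} : Equiv.Perm (Fin n) → obj n →ₗ[R] obj n
  perm_one {n : ℕ} (μ : obj n) : perm 1 μ = μ
  perm_mul {n : ℕ} (σ τ : Equiv.Perm (Fin n)) (μ : obj n) :
    perm (σ * τ) μ = perm τ (perm σ μ)
  /-- the partial composition: `circ h i μ ν` is `μ ∘ᵢ ν` -/
  circ {m n k : ℕ} (h : m + n = k + 1) (i : Fin m) : obj m →ₗ[R] obj n →ₗ[R] obj k
  one_circ {n : ℕ} (ν : obj n) : circ (Nat.add_comm 1 n) 0 one ν = ν
  circ_one {m : ℕ} (i : Fin m) (μ : obj m) : circ rfl i μ one = μ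
  /-- sequential associativity -/
  circ_circ_inner {l m n p q r : ℕ} (hp : l + m = p + 1) (hr : p + n = r + 1)
    (hq : m + n = q + 1) (hr' : l + q = r + 1) (i : Fin l) (j : Fin m)
    (lam : obj l) (μ : obj m) (ν : obj n) :
    circ hr (innerPos hp i j) (circ hp i lam μ) ν = circ hr' i lam (circ hq j μ ν)
  /-- parallel associativity -/
  circ_circ_outer {l m n p q r : ℕ} (hp : l + m = p + 1) (hr : p + n = r + 1)
    (hq : l + n = q + 1) (hr' : q + m = r + 1) (i j : Fin l) (hij : i ≠ j)
    (lam : obj l) (μ : obj m) (ν : obj n) :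
    circ hr (outerPos hp i ⟨j, hij.symm⟩) (circ hp i lam μ) ν =
      circ hr' (outerPos hq j ⟨i, hij⟩) (circ hq j lam ν) μ
  circ_perm {m n k : ℕ} (h : m + n = k + 1) (i : Fin m) (σ : Equiv.Perm (Fin n))
    (μ : obj m) (ν : obj n) :
    circ h i μ (perm σ ν) = perm (permInner h i σ) (circ h i μ ν)
  perm_circ {m n k : ℕ} (h : m + n = k + 1) (i : Fin m) (σ : Equiv.Perm (Fin m))
    (μ : obj m) (ν : obj n) :
    circ h i (perm σ μ) ν = perm (permOuter h i σ) (circ h (σ i) μ ν)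

namespace SymmOperad

attribute [instance] SymmOperad.addCommGroup SymmOperad.module

variable {R : Type u} [CommRing R]

/-! ## Algebras over an operad -/

/-- An algebra over the operad `P`: an `R`-module `A` with a linear map
`P(n) ⊗ A^{⊗ n} → A`, `μ ⊗ a₁ ⊗ … ⊗ aₙ ↦ μ(a₁, …, aₙ)`, for every `n`, which is invariant
under the symmetric group, unital, and compatible with (partial) composition. -/
structure Alg (P : SymmOperad R) where
  carrier : Type u
  [addCommGroup : AddCommGroup carrier]
  [module : Module R carrier]
  eval {n : ℕ} : P.obj n →ₗ[R] MultilinearMap R (fun _ : Fin n => carrier) carrier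
  eval_perm {n : ℕ} (σ : Equiv.Perm (Fin n)) (μ : P.obj n) (a : Fin n → carrier) :
    eval (P.perm σ μ) a = eval μ (fun j => a (σ.symm j))
  eval_one (a : Fin 1 → carrier) : eval P.one a = a 0
  eval_circ {m n k : ℕ} (h : m + n = k + 1) (i : Fin m) (μ : P.obj m) (ν : P.obj n)
    (a : Fin k → carrier) :
    eval (P.circ h i μ ν) a = eval μ (graft h i (fun b => eval ν b) a)

variable {P : SymmOperad R}

namespace Alg

attribute [instance] Alg.addCommGroup Alg.module

instance : CoeSort (Alg P) (Type u) := ⟨Alg.carrier⟩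

/-- A morphism of `P`-algebras. -/
@[ext]
structure Hom (A B : Alg P) where
  lin : A →ₗ[R] B
  map_eval {n : ℕ} (μ : P.obj n) (a : Fin n → A) :
    lin (A.eval μ a) = B.eval μ (fun j => lin (a j))

/-- The category of `P`-algebras. -/
instance : Category (Alg P) where
  Hom := Hom
  id A := ⟨LinearMap.id, fun _ _ => rfl⟩
  comp f g := ⟨g.lin ∘ₗ f.lin, fun μ a => by simp [f.map_eval, g.map_eval]⟩

instance (A B : Alg P) : CoeFun (A ⟶ B) (fun _ => A → B) := ⟨fun f => f.lin⟩

@[ext]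
theorem hom_ext {A B : Alg P} {f g : A ⟶ B} (h : ∀ a, f a = g a) : f = g :=
  Hom.ext (LinearMap.ext h)

@[simp] theorem id_apply (A : Alg P) (a : A) : (𝟙 A : A ⟶ A) a = a := rfl

@[simp] theorem comp_apply {A B C : Alg P} (f : A ⟶ B) (g : B ⟶ C) (a : A) :
    (f ≫ g) a = g (f a) := rfl

/-! ## The semi-direct product `A ⋉ A` -/

/-- The operation `μ` of the semi-direct product `A ⋉ A`. -/
def semiEval (A : Alg P) {n : ℕ} (μ : P.obj n) :
    MultilinearMap R (fun _ : Fin n => A × A) (A × A) :=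
  MultilinearMap.prod
    ((A.eval μ).compLinearMap (fun _ => LinearMap.fst R A A))
    (∑ i, (A.eval μ).compLinearMap
      (fun j => if j = i then LinearMap.snd R A A else LinearMap.fst R A A))

/-- `μ((a₁, b₁), …, (aₙ, bₙ)) = (μ(a₁, …, aₙ), ∑ᵢ μ(a₁, …, bᵢ, …, aₙ))`. -/
theorem semiEval_apply (A : Alg P) {n : ℕ} (μ : P.obj n) (p : Fin n → A × A) :
    A.semiEval μ p = (A.eval μ (fun j => (p j).1),
      ∑ i, A.eval μ (fun j => if j = i then (p j).2 else (p j).1)) := by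
  simp only [semiEval, MultilinearMap.prod_apply, sum_apply, MultilinearMap.compLinearMap_apply,
    LinearMap.fst_apply]
  congr 1
  refine Finset.sum_congr rfl fun i _ => ?_
  congr 1
  funext j
  split_ifs <;> rfl

theorem graft_pair_fst (A : Alg P) {m n k : ℕ} (h : m + n = k + 1) (i : Fin m) (ν : P.obj n)
    (p : Fin k → A × A) (j : Fin m) :
    (graft h i (fun b => A.semiEval ν b) p j).1 =
      graft h i (fun b => A.eval ν b) (fun s => (p s).1) j := by
  unfold graft
  split_ifs
  · simp only [semiEval_apply]
  · rfl

theorem semiEval_circ (A : Alg P) {m n k : ℕ} (h : m + n = k + 1) (i : Fin m) (μ : P.obj m)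
    (ν : P.obj n) (p : Fin k → A × A) :
    A.semiEval (P.circ h i μ ν) p = A.semiEval μ (graft h i (fun b => A.semiEval ν b) p) := by
  rw [semiEval_apply, semiEval_apply]
  refine Prod.ext ?_ ?_
  · simp only [A.eval_circ, graft_pair_fst]
  · simp only [A.eval_circ]
    rw [← (slots h i).sum_comp, Fintype.sum_sum_type, Fintype.sum_eq_add_sum_subtype_ne _ i]
    congr 1
    · have key : (fun j => if j = i then (graft h i (fun b => A.semiEval ν b) p j).2
          else (graft h i (fun b => A.semiEval ν b) p j).1) =
          Function.update (graft h i (fun b => A.eval ν b) (fun s => (p s).1)) i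
            (∑ t, A.eval ν (fun t' => if t' = t then (p (innerPos h i t')).2
              else (p (innerPos h i t')).1)) := by
        funext j
        by_cases hj : j = i
        · subst hj
          simp [graft, semiEval_apply]
        · simp only [if_neg hj, Function.update_of_ne hj, graft_pair_fst]
      rw [key, MultilinearMap.map_update_sum]
      refine Finset.sum_congr rfl fun t _ => ?_
      congr 1
      funext j
      by_cases hj : j = i
      · subst hj
        simp only [graft, dif_pos, Function.update_self]
        congr 1
        funext t'
        have : (innerPos h j t' = slots h j (Sum.inl t)) ↔ t' = t := by
          rw [show innerPos h j t' = slots h j (Sum.inl t') from rfl]; simp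
        simp only [this]
      · have : ¬ (outerPos h i ⟨j, hj⟩ = slots h i (Sum.inl t)) := by
          rw [show outerPos h i ⟨j, hj⟩ = slots h i (Sum.inr ⟨j, hj⟩) from rfl]; simp
        simp only [graft, dif_neg hj, Function.update_of_ne hj, if_neg this]
    · refine Finset.sum_congr rfl fun j' _ => ?_
      congr 1
      funext j
      rw [graft_pair_fst]
      by_cases hj : j = i
      · subst hj
        rw [if_neg (fun e => j'.2 e.symm)]
        simp only [graft, dif_pos]
        congr 1
        funext t'
        have : ¬ (innerPos h j t' = slots h j (Sum.inr j')) := by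
          rw [show innerPos h j t' = slots h j (Sum.inl t') from rfl]; simp
        rw [if_neg this]
      · have : (outerPos h i ⟨j, hj⟩ = slots h i (Sum.inr j')) ↔ j = j' := by
          rw [show outerPos h i ⟨j, hj⟩ = slots h i (Sum.inr ⟨j, hj⟩) from rfl]
          simp [Subtype.ext_iff]
        simp only [graft, dif_neg hj, this]

/-- The semi-direct product `A ⋉ A`: the `R`-module `A × A` with the operations
`μ((a₁, b₁), …, (aₙ, bₙ)) = (μ(a₁, …, aₙ), ∑ᵢ μ(a₁, …, bᵢ, …, aₙ))`. -/
def semidirect (A : Alg P) : Alg P where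
  carrier := A × A
  eval :=
    { toFun := A.semiEval
      map_add' := fun μ ν => by
        ext1 p
        simp only [add_apply, semiEval_apply, map_add, Finset.sum_add_distrib,
          Prod.mk_add_mk]
      map_smul' := fun r μ => by
        ext1 p
        simp only [smul_apply, semiEval_apply, map_smul, ← Finset.smul_sum,
          Prod.smul_mk, RingHom.id_apply] }
  eval_perm σ μ p := by
    simp only [LinearMap.coe_mk, AddHom.coe_mk, semiEval_apply, A.eval_perm]
    congr 1
    refine Fintype.sum_equiv σ _ _ fun i => ?_
    simp only [Equiv.symm_apply_eq]
  eval_one p := by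
    simp [semiEval_apply, A.eval_one]
  eval_circ h i μ ν p := A.semiEval_circ h i μ ν p

theorem semidirect_eval (A : Alg P) {n : ℕ} (μ : P.obj n) (p : Fin n → A × A) :
    A.semidirect.eval μ p = (A.eval μ (fun j => (p j).1),
      ∑ i, A.eval μ (fun j => if j = i then (p j).2 else (p j).1)) :=
  A.semiEval_apply μ p

end Alg

/-- The tangent functor `T(A) = A ⋉ A`, `T(f)(a, b) = (f(a), f(b))`. -/
def tangent (P : SymmOperad R) : Alg P ⥤ Alg P where
  obj A := A.semidirect
  map {A B} f :=
    { lin := LinearMap.prodMap f.lin f.lin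
      map_eval := fun μ p => by
        refine (congrArg (LinearMap.prodMap f.lin f.lin) (A.semidirect_eval μ p)).trans
          (Eq.trans ?_ (B.semidirect_eval μ _).symm)
        refine Prod.ext (f.map_eval μ _) ?_
        simp only [LinearMap.prodMap_apply, map_sum, f.map_eval]
        refine Finset.sum_congr rfl fun i _ => ?_
        congr 1
        funext j
        split_ifs <;> rfl }

/-! ## Modules over an algebra, and derivations -/

/-- A module over the `P`-algebra `A`: an `R`-module `M` with linear maps
`P(n+1) ⊗ A^{⊗ n} ⊗ M → M`, written `μ(a₁, …, aₙ, x)`, which are equivariant, unital and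
compatible with composition. The last input is the one that takes values in `M`. -/
structure Mod (A : Alg P) where
  carrier : Type u
  [addCommGroup : AddCommGroup carrier]
  [module : Module R carrier]
  act {n : ℕ} : P.obj (n + 1) →ₗ[R]
    MultilinearMap R (fun _ : Fin n => A.carrier) (carrier →ₗ[R] carrier)
  act_perm {n : ℕ} (σ : Equiv.Perm (Fin n)) (μ : P.obj (n + 1)) (a : Fin n → A) (x : carrier) :
    act (P.perm (permInit σ) μ) a x = act μ (fun j => a (σ.symm j)) x
  act_one (a : Fin 0 → A) (x : carrier) : act P.one a x = x
  /-- composition in one of the inputs that take values in `A` -/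
  act_circ_init {m n k : ℕ} (h : m + 1 + n = k + 1 + 1) (h' : m + n = k + 1) (i : Fin m)
    (μ : P.obj (m + 1)) (ν : P.obj n) (a : Fin k → A) (x : carrier) :
    act (P.circ h i.castSucc μ ν) a x = act μ (graft h' i (fun b => A.eval ν b) a) x
  /-- composition in the last input -/
  act_circ_last {m n : ℕ} (h : m + 1 + (n + 1) = m + n + 1 + 1) (μ : P.obj (m + 1))
    (ν : P.obj (n + 1)) (a : Fin (m + n) → A) (x : carrier) :
    act (P.circ h (Fin.last m) μ ν) a x =
      act μ (fun j => a (Fin.castAdd n j)) (act ν (fun t => a (Fin.natAdd m t)) x)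

namespace Mod

attribute [instance] Mod.addCommGroup Mod.module

instance (A : Alg P) : CoeSort (Mod A) (Type u) := ⟨Mod.carrier⟩

variable {A : Alg P}

/-- The shorthand `μ(a₁, …, x, …, aₙ)`, with `x` in place of `aᵢ`:
`(μ · (i i+1 … n))(a₁, …, aᵢ₋₁, aᵢ₊₁, …, aₙ, x)`. -/
def actAt (M : Mod A) : {n : ℕ} → P.obj n → Fin n → (Fin n → A) → M → M
  | 0, _, i, _, _ => i.elim0
  | _ + 1, μ, i, a, x => M.act (P.perm (cycleLast i) μ) (fun j => a (i.succAbove j)) x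

/-- An `A`-linear morphism. -/
structure Hom (M N : Mod A) where
  lin : M →ₗ[R] N
  map_act {n : ℕ} (μ : P.obj (n + 1)) (a : Fin n → A) (x : M) :
    lin (M.act μ a x) = N.act μ a (lin x)

theorem Hom.ext' {M N : Mod A} {f g : Hom M N} (h : ∀ x, f.lin x = g.lin x) : f = g := by
  cases f; cases g; congr 1; exact LinearMap.ext h

end Mod

/-- An `A`-derivation evaluated in the `A`-module `M`. -/
structure Der (A : Alg P) (M : Mod A) where
  lin : A →ₗ[R] M
  leibniz {n : ℕ} (μ : P.obj n) (a : Fin n → A) :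
    lin (A.eval μ a) = ∑ i, M.actAt μ i a (lin (a i))

/-! ## The module of Kähler differentials -/

namespace Kaehler

/-- Expressions in the symbols `d a`, the operations of an `A`-module and those of an
`R`-module. -/
inductive Pre (A : Alg P) : Type u
  | d (a : A) : Pre A
  | act {n : ℕ} (μ : P.obj (n + 1)) (a : Fin n → A) (x : Pre A) : Pre A
  | zero : Pre A
  | add (x y : Pre A) : Pre A
  | smul (r : R) (x : Pre A) : Pre A

/-- The expression `μ(a₁, …, x, …, aₙ)` with `x` in place of `aᵢ`. -/
def Pre.actAt {A : Alg P} : {n : ℕ} → P.obj n → Fin n → (Fin n → A) → Pre A → Pre A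
  | 0, _, i, _, _ => i.elim0
  | _ + 1, μ, i, a, x => .act (P.perm (cycleLast i) μ) (fun j => a (i.succAbove j)) x

/-- The sum of a finite family of expressions. -/
def Pre.sum {A : Alg P} : {n : ℕ} → (Fin n → Pre A) → Pre A
  | 0, _ => .zero
  | _ + 1, f => .add (f 0) (Pre.sum fun i => f i.succ)

/-- The relations of `Ω_A`: the axioms of an `A`-module, linearity of `d`, and the Leibniz rule. -/
inductive Rel (A : Alg P) : Pre A → Pre A → Prop
  | refl (x) : Rel A x x
  | symm {x y} : Rel A x y → Rel A y x
  | trans {x y z} : Rel A x y → Rel A y z → Rel A x z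
  -- congruence
  | act_congr {n : ℕ} (μ : P.obj (n + 1)) (a : Fin n → A) {x y} :
      Rel A x y → Rel A (.act μ a x) (.act μ a y)
  | add_congr {x x' y y'} : Rel A x x' → Rel A y y' → Rel A (.add x y) (.add x' y')
  | smul_congr (r : R) {x x'} : Rel A x x' → Rel A (.smul r x) (.smul r x')
  -- `R`-module
  | add_assoc (x y z) : Rel A (.add (.add x y) z) (.add x (.add y z))
  | add_comm (x y) : Rel A (.add x y) (.add y x)
  | zero_add (x) : Rel A (.add .zero x) x
  | one_smul (x) : Rel A (.smul 1 x) x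
  | mul_smul (r s : R) (x) : Rel A (.smul (r * s) x) (.smul r (.smul s x))
  | smul_add (r : R) (x y) : Rel A (.smul r (.add x y)) (.add (.smul r x) (.smul r y))
  | add_smul (r s : R) (x) : Rel A (.smul (r + s) x) (.add (.smul r x) (.smul s x))
  | zero_smul (x) : Rel A (.smul 0 x) .zero
  -- linearity of the action in each of its arguments
  | op_add {n : ℕ} (μ ν : P.obj (n + 1)) (a : Fin n → A) (x) :
      Rel A (.act (μ + ν) a x) (.add (.act μ a x) (.act ν a x))
  | op_smul {n : ℕ} (r : R) (μ : P.obj (n + 1)) (a : Fin n → A) (x) :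
      Rel A (.act (r • μ) a x) (.smul r (.act μ a x))
  | arg_add {n : ℕ} (μ : P.obj (n + 1)) (a : Fin n → A) (i : Fin n) (b c : A) (x) :
      Rel A (.act μ (Function.update a i (b + c)) x)
        (.add (.act μ (Function.update a i b) x) (.act μ (Function.update a i c) x))
  | arg_smul {n : ℕ} (μ : P.obj (n + 1)) (a : Fin n → A) (i : Fin n) (r : R) (b : A) (x) :
      Rel A (.act μ (Function.update a i (r • b)) x) (.smul r (.act μ (Function.update a i b) x))
  | act_add {n : ℕ} (μ : P.obj (n + 1)) (a : Fin n → A) (x y) :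
      Rel A (.act μ a (.add x y)) (.add (.act μ a x) (.act μ a y))
  | act_smul {n : ℕ} (μ : P.obj (n + 1)) (a : Fin n → A) (r : R) (x) :
      Rel A (.act μ a (.smul r x)) (.smul r (.act μ a x))
  -- `A`-module
  | act_perm {n : ℕ} (σ : Equiv.Perm (Fin n)) (μ : P.obj (n + 1)) (a : Fin n → A) (x) :
      Rel A (.act (P.perm (permInit σ) μ) a x) (.act μ (fun j => a (σ.symm j)) x)
  | act_one (a : Fin 0 → A) (x) : Rel A (.act P.one a x) x
  | act_circ_init {m n k : ℕ} (h : m + 1 + n = k + 1 + 1) (h' : m + n = k + 1) (i : Fin m)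
      (μ : P.obj (m + 1)) (ν : P.obj n) (a : Fin k → A) (x) :
      Rel A (.act (P.circ h i.castSucc μ ν) a x)
        (.act μ (graft h' i (fun b => A.eval ν b) a) x)
  | act_circ_last {m n : ℕ} (h : m + 1 + (n + 1) = m + n + 1 + 1) (μ : P.obj (m + 1))
      (ν : P.obj (n + 1)) (a : Fin (m + n) → A) (x) :
      Rel A (.act (P.circ h (Fin.last m) μ ν) a x)
        (.act μ (fun j => a (Fin.castAdd n j)) (.act ν (fun t => a (Fin.natAdd m t)) x))
  -- `d` is a derivation
  | d_add (a b : A) : Rel A (.d (a + b)) (.add (.d a) (.d b))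
  | d_smul (r : R) (a : A) : Rel A (.d (r • a)) (.smul r (.d a))
  | leibniz {n : ℕ} (μ : P.obj n) (a : Fin n → A) :
      Rel A (.d (A.eval μ a)) (Pre.sum fun i => Pre.actAt μ i a (.d (a i)))

/-- The equivalence relation on expressions generated by the relations of `Ω_A`. -/
instance setoid (A : Alg P) : Setoid (Pre A) := ⟨Rel A, .refl, .symm, .trans⟩

/-- The underlying set of `Ω_A`. -/
def Carrier (A : Alg P) : Type u := Quotient (setoid A)

variable {A : Alg P}

/-- The class of an expression. -/
def cls (x : Pre A) : Carrier A := Quotient.mk _ x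

theorem sound {x y : Pre A} (h : Rel A x y) : cls x = cls y := Quotient.sound h

instance : Zero (Carrier A) := ⟨cls .zero⟩

instance : Add (Carrier A) :=
  ⟨Quotient.map₂ Pre.add fun _ _ h _ _ h' => Rel.add_congr h h'⟩

instance : SMul R (Carrier A) :=
  ⟨fun r => Quotient.map (Pre.smul r) fun _ _ h => Rel.smul_congr r h⟩

theorem ind {p : Carrier A → Prop} (h : ∀ x, p (cls x)) (x : Carrier A) : p x :=
  Quotient.ind h x

theorem add_comm' (x y : Carrier A) : x + y = y + x := by
  induction x using ind; induction y using ind; exact sound (.add_comm _ _)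

theorem zero_add' (x : Carrier A) : 0 + x = x := by
  induction x using ind; exact sound (.zero_add _)

instance : Neg (Carrier A) := ⟨fun x => (-1 : R) • x⟩

instance : AddCommGroup (Carrier A) where
  add_assoc x y z := by
    induction x using ind; induction y using ind; induction z using ind
    exact sound (.add_assoc _ _ _)
  add_comm := add_comm'
  zero_add := zero_add'
  add_zero x := by rw [add_comm', zero_add']
  nsmul := nsmulRec
  zsmul := zsmulRec
  neg_add_cancel x := by
    induction x using ind with | _ x
    change cls (.add (.smul (-1) x) x) = cls .zero
    refine sound (.trans (.add_congr (.refl _) (.symm (.one_smul x))) ?_)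
    refine .trans (.symm (.add_smul _ _ _)) ?_
    rw [neg_add_cancel]
    exact .zero_smul _

instance : Module R (Carrier A) where
  one_smul x := by induction x using ind; exact sound (.one_smul _)
  mul_smul r s x := by induction x using ind; exact sound (.mul_smul _ _ _)
  smul_zero r := by
    change cls (.smul r .zero) = cls .zero
    refine sound (.trans (.smul_congr r (.symm (.zero_smul .zero))) ?_)
    refine .trans (.symm (.mul_smul _ _ _)) ?_
    rw [mul_zero]
    exact .zero_smul _
  smul_add r x y := by
    induction x using ind; induction y using ind; exact sound (.smul_add _ _ _)
  add_smul r s x := by induction x using ind; exact sound (.add_smul _ _ _)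
  zero_smul x := by induction x using ind; exact sound (.zero_smul _)

/-- The action on `Ω_A`, as a linear map in its last argument. -/
def actLin {n : ℕ} (μ : P.obj (n + 1)) (a : Fin n → A) : Carrier A →ₗ[R] Carrier A where
  toFun := Quotient.map (Pre.act μ a) fun _ _ h => Rel.act_congr μ a h
  map_add' x y := by
    induction x using ind; induction y using ind; exact sound (.act_add _ _ _ _)
  map_smul' r x := by induction x using ind; exact sound (.act_smul _ _ _ _)

theorem actLin_cls {n : ℕ} (μ : P.obj (n + 1)) (a : Fin n → A) (x : Pre A) :
    actLin μ a (cls x) = cls (.act μ a x) := rfl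

end Kaehler

open Kaehler in
/-- The module of Kähler differentials `Ω_A`: the `A`-module generated by symbols `d a`,
`a ∈ A`, subject to the relations that make `d` a derivation. -/
def kaehler (A : Alg P) : Mod A where
  carrier := Kaehler.Carrier A
  act {n} :=
    { toFun := fun μ => MultilinearMap.mk' (fun a => actLin μ a)
        (fun a i b c => LinearMap.ext fun x => by
          induction x using ind; exact sound (.arg_add _ _ _ _ _ _))
        (fun a i r b => LinearMap.ext fun x => by
          induction x using ind; exact sound (.arg_smul _ _ _ _ _ _))
      map_add' := fun μ ν => MultilinearMap.ext fun a => LinearMap.ext fun x => by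
        induction x using ind; exact sound (.op_add _ _ _ _)
      map_smul' := fun r μ => MultilinearMap.ext fun a => LinearMap.ext fun x => by
        induction x using ind; exact sound (.op_smul _ _ _ _) }
  act_perm σ μ a x := by induction x using ind; exact sound (.act_perm _ _ _ _)
  act_one a x := by induction x using ind; exact sound (.act_one _ _)
  act_circ_init h h' i μ ν a x := by
    induction x using ind; exact sound (.act_circ_init h h' i μ ν a _)
  act_circ_last h μ ν a x := by induction x using ind; exact sound (.act_circ_last h μ ν a _)

namespace Kaehler

variable {A : Alg P}

theorem cls_actAt {n : ℕ} (μ : P.obj n) (i : Fin n) (a : Fin n → A) (x : Pre A) :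
    cls (Pre.actAt μ i a x) = (kaehler A).actAt μ i a (cls x) := by
  cases n with
  | zero => exact i.elim0
  | succ n => rfl

theorem cls_sum {n : ℕ} (f : Fin n → Pre A) : cls (Pre.sum f) = ∑ i, cls (f i) := by
  induction n with
  | zero => rfl
  | succ n ih => rw [Fin.sum_univ_succ, ← ih]; rfl

end Kaehler

open Kaehler in
/-- The universal derivation `d : A → Ω_A`. -/
def kaehlerD (A : Alg P) : Der A (kaehler A) where
  lin :=
    { toFun := fun a => (cls (Pre.d a) : Carrier A)
      map_add' := fun _ _ => sound (.d_add _ _)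
      map_smul' := fun _ _ => sound (.d_smul _ _) }
  leibniz μ a := by
    refine (sound (Rel.leibniz μ a)).trans ((cls_sum _).trans ?_)
    exact Finset.sum_congr rfl fun i _ => cls_actAt μ i a _

namespace Mod

variable {A : Alg P}

theorem Hom.map_actAt {M N : Mod A} (f : Hom M N) {n : ℕ} (μ : P.obj n) (i : Fin n)
    (a : Fin n → A) (x : M) : f.lin (M.actAt μ i a x) = N.actAt μ i a (f.lin x) := by
  cases n with
  | zero => exact i.elim0
  | succ n => exact f.map_act _ _ _

end Mod

namespace Kaehler

variable {A : Alg P} {M : Mod A} (D : Der A M)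

/-- The value of an expression when `d` is interpreted as the derivation `D`. -/
def interp : Pre A → M
  | .d a => D.lin a
  | .act μ a x => M.act μ a (interp x)
  | .zero => 0
  | .add x y => interp x + interp y
  | .smul r x => r • interp x

theorem interp_actAt {n : ℕ} (μ : P.obj n) (i : Fin n) (a : Fin n → A) (x : Pre A) :
    interp D (Pre.actAt μ i a x) = M.actAt μ i a (interp D x) := by
  cases n with
  | zero => exact i.elim0
  | succ n => rfl

theorem interp_sum {n : ℕ} (f : Fin n → Pre A) :
    interp D (Pre.sum f) = ∑ i, interp D (f i) := by
  induction n with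
  | zero => rfl
  | succ n ih => rw [Fin.sum_univ_succ, ← ih]; rfl

theorem interp_rel {x y : Pre A} (h : Rel A x y) : interp D x = interp D y := by
  induction h with
  | refl => rfl
  | symm _ ih => exact ih.symm
  | trans _ _ ih ih' => exact ih.trans ih'
  | act_congr μ a _ ih => simp only [interp, ih]
  | add_congr _ _ ih ih' => simp only [interp, ih, ih']
  | smul_congr r _ ih => simp only [interp, ih]
  | add_assoc => exact add_assoc _ _ _
  | add_comm => exact add_comm _ _
  | zero_add => exact zero_add _
  | one_smul => exact one_smul _ _
  | mul_smul => exact mul_smul _ _ _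
  | smul_add => exact smul_add _ _ _
  | add_smul => exact add_smul _ _ _
  | zero_smul => exact zero_smul _ _
  | op_add => simp [interp]
  | op_smul => simp [interp]
  | arg_add => simp [interp]
  | arg_smul => simp [interp]
  | act_add => simp [interp]
  | act_smul => simp [interp]
  | act_perm => exact M.act_perm _ _ _ _
  | act_one => exact M.act_one _ _
  | act_circ_init h h' i μ ν a x => exact M.act_circ_init h h' i μ ν a _
  | act_circ_last h μ ν a x => exact M.act_circ_last h μ ν a _
  | d_add => exact map_add _ _ _
  | d_smul => exact map_smul _ _ _
  | leibniz μ a =>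
    rw [interp_sum]
    simp only [interp_actAt]
    exact D.leibniz μ a

/-- The `A`-linear morphism `Ω_A → M` induced by a derivation `A → M`. -/
def lift : Mod.Hom (kaehler A) M where
  lin :=
    { toFun := Quotient.lift (interp D) fun _ _ h => interp_rel D h
      map_add' := fun x y => by induction x using ind; induction y using ind; rfl
      map_smul' := fun r x => by induction x using ind; rfl }
  map_act μ a x := by induction x using ind; rfl

theorem lift_d (a : A) : (lift D).lin ((kaehlerD A).lin a) = D.lin a := rfl

theorem hom_ext {f g : Mod.Hom (kaehler A) M}
    (h : ∀ a, f.lin ((kaehlerD A).lin a) = g.lin ((kaehlerD A).lin a)) : f = g := by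
  refine Mod.Hom.ext' fun x => ?_
  induction x using ind with | _ x
  induction x with
  | d a => exact h a
  | act μ a x ih =>
    exact (f.map_act μ a (cls x)).trans
      ((congrArg (M.act μ a) ih).trans (g.map_act μ a (cls x)).symm)
  | zero => exact (map_zero f.lin).trans (map_zero g.lin).symm
  | add x y ih ih' =>
    exact (map_add f.lin (cls x) (cls y)).trans
      ((congrArg₂ (· + ·) ih ih').trans (map_add g.lin (cls x) (cls y)).symm)
  | smul r x ih =>
    exact (map_smul f.lin r (cls x)).trans
      ((congrArg (r • ·) ih).trans (map_smul g.lin r (cls x)).symm)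

end Kaehler

/-- `d : A → Ω_A` is the universal derivation. -/
theorem kaehler_universal (A : Alg P) (M : Mod A) (D : Der A M) :
    ∃! f : Mod.Hom (kaehler A) M, ∀ a, f.lin ((kaehlerD A).lin a) = D.lin a :=
  ⟨Kaehler.lift D, Kaehler.lift_d D, fun _ hg => Kaehler.hom_ext fun a => hg a⟩

/-! ## The free `A`-algebra over an `A`-module -/

theorem map_snoc {X Y : Type*} (φ : X → Y) {n : ℕ} (a : Fin n → X) (x : X) (j : Fin (n + 1)) :
    φ (Fin.snoc (α := fun _ => X) a x j) =
      Fin.snoc (α := fun _ => Y) (fun j => φ (a j)) (φ x) j := by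
  refine Fin.lastCases ?_ (fun j => ?_) j
  · rw [Fin.snoc_last, Fin.snoc_last]
  · rw [Fin.snoc_castSucc, Fin.snoc_castSucc]

theorem eval_snoc_perm (B : Alg P) {n : ℕ} (σ : Equiv.Perm (Fin n)) (μ : P.obj (n + 1))
    (b : Fin n → B) (x : B) :
    B.eval (P.perm (permInit σ) μ) (Fin.snoc (α := fun _ => B.carrier) b x) =
      B.eval μ (Fin.snoc (α := fun _ => B.carrier) (fun j => b (σ.symm j)) x) := by
  rw [B.eval_perm]
  congr 1
  funext j
  refine Fin.lastCases ?_ (fun j => ?_) j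
  · have : (permInit σ).symm (Fin.last n) = Fin.last n := by
      rw [Equiv.symm_apply_eq]; simp [permInit]
    rw [this, Fin.snoc_last, Fin.snoc_last]
  · have : (permInit σ).symm j.castSucc = (σ.symm j).castSucc := by
      rw [Equiv.symm_apply_eq]; simp [permInit]
    rw [this, Fin.snoc_castSucc, Fin.snoc_castSucc]

/-- The `A`-module underlying the `A`-algebra `u : A → B`:
`μ(a₁, …, aₙ, b) = μ(u(a₁), …, u(aₙ), b)`. -/
def restrict {A B : Alg P} (u : A ⟶ B) : Mod A where
  carrier := B
  act {n} :=
    { toFun := fun μ => (B.eval μ).curryRight.compLinearMap (fun _ => u.lin)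
      map_add' := fun μ ν => by ext a x; simp
      map_smul' := fun r μ => by ext a x; simp }
  act_perm σ μ a x := eval_snoc_perm B σ μ (fun j => u (a j)) x
  act_one a x := by
    refine (B.eval_one _).trans ?_
    rfl
  act_circ_init {m n k} h h' i μ ν a x := by
    refine (B.eval_circ h _ μ ν _).trans ?_
    refine congrArg (B.eval μ) (funext fun j => ?_)
    change graft h i.castSucc _ _ j = Fin.snoc (α := fun _ => B.carrier)
      (fun j => u (graft h' i (fun b => A.eval ν b) a j)) x j
    refine Fin.lastCases ?_ (fun j => ?_) j
    · have hi : Fin.last m ≠ i.castSucc := (Fin.castSucc_lt_last i).ne'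
      have e : outerPos h i.castSucc ⟨Fin.last m, hi⟩ = Fin.last k := by
        ext
        have := i.2
        simp only [outerPos, Fin.lt_def, Fin.val_last, Fin.val_castSucc]
        split_ifs <;> omega
      rw [Fin.snoc_last, graft, dif_neg hi, e, Fin.snoc_last]
    · rw [Fin.snoc_castSucc]
      by_cases hj : j = i
      · subst hj
        rw [graft, graft, dif_pos rfl, dif_pos rfl, u.map_eval]
        refine congrArg (B.eval ν) (funext fun t => ?_)
        exact Fin.snoc_castSucc (α := fun _ => B.carrier) _ _ (innerPos h' j t)
      · have hj' : j.castSucc ≠ i.castSucc := fun e => hj (Fin.castSucc_injective _ e)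
        rw [graft, graft, dif_neg hj', dif_neg hj]
        exact Fin.snoc_castSucc (α := fun _ => B.carrier) _ _ (outerPos h' i ⟨j, hj⟩)
  act_circ_last {m n} h μ ν a x := by
    refine (B.eval_circ h _ μ ν _).trans ?_
    refine congrArg (B.eval μ) (funext fun j => ?_)
    change graft h (Fin.last m) _ _ j = Fin.snoc (α := fun _ => B.carrier)
      (fun j => u (a (Fin.castAdd n j))) (B.eval ν (Fin.snoc (α := fun _ => B.carrier)
        (fun t => u (a (Fin.natAdd m t))) x)) j
    refine Fin.lastCases ?_ (fun j => ?_) j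
    · rw [Fin.snoc_last, graft, dif_pos rfl]
      refine congrArg (B.eval ν) (funext fun t => ?_)
      refine Fin.lastCases ?_ (fun t => ?_) t
      · rw [Fin.snoc_last]
        exact Fin.snoc_last (α := fun _ => B.carrier) _ _
      · rw [Fin.snoc_castSucc]
        exact Fin.snoc_castSucc (α := fun _ => B.carrier) _ _ (Fin.natAdd m t)
    · have hj : j.castSucc ≠ Fin.last m := (Fin.castSucc_lt_last j).ne
      have e : outerPos h (Fin.last m) ⟨j.castSucc, hj⟩ = (Fin.castAdd n j).castSucc := by
        ext
        simp [outerPos, Fin.lt_def]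
      rw [Fin.snoc_castSucc, graft, dif_neg hj, e, Fin.snoc_castSucc]

theorem restrict_act {A B : Alg P} (u : A ⟶ B) {n : ℕ} (μ : P.obj (n + 1)) (a : Fin n → A)
    (b : B) : (restrict u).act μ a b =
      B.eval μ (Fin.snoc (α := fun _ => B.carrier) (fun j => u (a j)) b) := rfl

namespace FreeAlg

/-- Expressions in the elements of `A` and of `M`, the operations of a `P`-algebra and those of
an `R`-module. -/
inductive Pre {A : Alg P} (M : Mod A) : Type u
  | base (a : A) : Pre M
  | gen (x : M) : Pre M
  | op {n : ℕ} (μ : P.obj n) (ts : Fin n → Pre M) : Pre M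
  | zero : Pre M
  | add (s t : Pre M) : Pre M
  | smul (r : R) (t : Pre M) : Pre M

/-- The relations of `Free_A(M)`: the axioms of a `P`-algebra, those that make `A → Free_A(M)`
a morphism of `P`-algebras, and those that make `M → Free_A(M)` a morphism of `A`-modules. -/
inductive Rel {A : Alg P} (M : Mod A) : Pre M → Pre M → Prop
  | refl (t) : Rel M t t
  | symm {s t} : Rel M s t → Rel M t s
  | trans {s t v} : Rel M s t → Rel M t v → Rel M s v
  -- congruence
  | op_congr {n : ℕ} (μ : P.obj n) {ts ts' : Fin n → Pre M} :
      (∀ j, Rel M (ts j) (ts' j)) → Rel M (.op μ ts) (.op μ ts')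
  | add_congr {s s' t t'} : Rel M s s' → Rel M t t' → Rel M (.add s t) (.add s' t')
  | smul_congr (r : R) {t t'} : Rel M t t' → Rel M (.smul r t) (.smul r t')
  -- `R`-module
  | add_assoc (s t v) : Rel M (.add (.add s t) v) (.add s (.add t v))
  | add_comm (s t) : Rel M (.add s t) (.add t s)
  | zero_add (t) : Rel M (.add .zero t) t
  | one_smul (t) : Rel M (.smul 1 t) t
  | mul_smul (r r' : R) (t) : Rel M (.smul (r * r') t) (.smul r (.smul r' t))
  | smul_add (r : R) (s t) : Rel M (.smul r (.add s t)) (.add (.smul r s) (.smul r t))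
  | add_smul (r r' : R) (t) : Rel M (.smul (r + r') t) (.add (.smul r t) (.smul r' t))
  | zero_smul (t) : Rel M (.smul 0 t) .zero
  -- linearity of the operations in each of their arguments
  | op_add {n : ℕ} (μ ν : P.obj n) (ts : Fin n → Pre M) :
      Rel M (.op (μ + ν) ts) (.add (.op μ ts) (.op ν ts))
  | op_smul {n : ℕ} (r : R) (μ : P.obj n) (ts : Fin n → Pre M) :
      Rel M (.op (r • μ) ts) (.smul r (.op μ ts))
  | arg_add {n : ℕ} (μ : P.obj n) (ts : Fin n → Pre M) (i : Fin n) (s t) :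
      Rel M (.op μ (Function.update ts i (.add s t)))
        (.add (.op μ (Function.update ts i s)) (.op μ (Function.update ts i t)))
  | arg_smul {n : ℕ} (μ : P.obj n) (ts : Fin n → Pre M) (i : Fin n) (r : R) (t) :
      Rel M (.op μ (Function.update ts i (.smul r t)))
        (.smul r (.op μ (Function.update ts i t)))
  -- `P`-algebra
  | op_perm {n : ℕ} (σ : Equiv.Perm (Fin n)) (μ : P.obj n) (ts : Fin n → Pre M) :
      Rel M (.op (P.perm σ μ) ts) (.op μ (fun j => ts (σ.symm j)))
  | op_one (ts : Fin 1 → Pre M) : Rel M (.op P.one ts) (ts 0)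
  | op_circ {m n k : ℕ} (h : m + n = k + 1) (i : Fin m) (μ : P.obj m) (ν : P.obj n)
      (ts : Fin k → Pre M) :
      Rel M (.op (P.circ h i μ ν) ts) (.op μ (graft h i (fun b => .op ν b) ts))
  -- `A → Free_A(M)` is a morphism of `P`-algebras
  | base_add (a b : A) : Rel M (.base (a + b)) (.add (.base a) (.base b))
  | base_smul (r : R) (a : A) : Rel M (.base (r • a)) (.smul r (.base a))
  | base_eval {n : ℕ} (μ : P.obj n) (a : Fin n → A) :
      Rel M (.base (A.eval μ a)) (.op μ (fun j => .base (a j)))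
  -- `M → Free_A(M)` is a morphism of `A`-modules
  | gen_add (x y : M) : Rel M (.gen (x + y)) (.add (.gen x) (.gen y))
  | gen_smul (r : R) (x : M) : Rel M (.gen (r • x)) (.smul r (.gen x))
  | gen_act {n : ℕ} (μ : P.obj (n + 1)) (a : Fin n → A) (x : M) :
      Rel M (.gen (M.act μ a x))
        (.op μ (Fin.snoc (α := fun _ => Pre M) (fun j => .base (a j)) (.gen x)))

/-- The equivalence relation on expressions generated by the relations of `Free_A(M)`. -/
instance setoid {A : Alg P} (M : Mod A) : Setoid (Pre M) := ⟨Rel M, .refl, .symm, .trans⟩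

/-- The underlying set of `Free_A(M)`. -/
def Carrier {A : Alg P} (M : Mod A) : Type u := Quotient (setoid M)

variable {A : Alg P} {M : Mod A}

/-- The class of an expression. -/
def cls (t : Pre M) : Carrier M := Quotient.mk _ t

theorem sound {s t : Pre M} (h : Rel M s t) : cls s = cls t := Quotient.sound h

instance : Zero (Carrier M) := ⟨cls .zero⟩

instance : Add (Carrier M) :=
  ⟨Quotient.map₂ Pre.add fun _ _ h _ _ h' => Rel.add_congr h h'⟩

instance : SMul R (Carrier M) :=
  ⟨fun r => Quotient.map (Pre.smul r) fun _ _ h => Rel.smul_congr r h⟩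

theorem ind {p : Carrier M → Prop} (h : ∀ t, p (cls t)) (t : Carrier M) : p t :=
  Quotient.ind h t

theorem ind_pi {n : ℕ} {p : (Fin n → Carrier M) → Prop} (h : ∀ ts : Fin n → Pre M, p (fun j => cls (ts j)))
    (q : Fin n → Carrier M) : p q := by
  have := h (fun j => (q j).out)
  rwa [show (fun j => cls (q j).out) = q from funext fun j => Quotient.out_eq (q j)] at this

theorem add_comm' (x y : Carrier M) : x + y = y + x := by
  induction x using ind; induction y using ind; exact sound (.add_comm _ _)

theorem zero_add' (x : Carrier M) : 0 + x = x := by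
  induction x using ind; exact sound (.zero_add _)

instance : Neg (Carrier M) := ⟨fun x => (-1 : R) • x⟩

instance : AddCommGroup (Carrier M) where
  add_assoc x y z := by
    induction x using ind; induction y using ind; induction z using ind
    exact sound (.add_assoc _ _ _)
  add_comm := add_comm'
  zero_add := zero_add'
  add_zero x := by rw [add_comm', zero_add']
  nsmul := nsmulRec
  zsmul := zsmulRec
  neg_add_cancel x := by
    induction x using ind with | _ x
    change cls (.add (.smul (-1) x) x) = cls .zero
    refine sound (.trans (.add_congr (.refl _) (.symm (.one_smul x))) ?_)
    refine .trans (.symm (.add_smul _ _ _)) ?_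
    rw [neg_add_cancel]
    exact .zero_smul _

instance : Module R (Carrier M) where
  one_smul x := by induction x using ind; exact sound (.one_smul _)
  mul_smul r s x := by induction x using ind; exact sound (.mul_smul _ _ _)
  smul_zero r := by
    change cls (.smul r .zero) = cls .zero
    refine sound (.trans (.smul_congr r (.symm (.zero_smul .zero))) ?_)
    refine .trans (.symm (.mul_smul _ _ _)) ?_
    rw [mul_zero]
    exact .zero_smul _
  smul_add r x y := by
    induction x using ind; induction y using ind; exact sound (.smul_add _ _ _)
  add_smul r s x := by induction x using ind; exact sound (.add_smul _ _ _)
  zero_smul x := by induction x using ind; exact sound (.zero_smul _)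

/-- The operation `μ` on classes of expressions. -/
noncomputable def opFun {n : ℕ} (μ : P.obj n) (q : Fin n → Carrier M) : Carrier M :=
  cls (.op μ fun j => (q j).out)

theorem opFun_cls {n : ℕ} (μ : P.obj n) (ts : Fin n → Pre M) :
    opFun μ (fun j => cls (ts j)) = cls (.op μ ts) :=
  sound (.op_congr μ fun j => Quotient.exact (Quotient.out_eq (cls (ts j))))

theorem update_cls {n : ℕ} (ts : Fin n → Pre M) (i : Fin n) (t : Pre M) :
    Function.update (fun j => cls (ts j)) i (cls t) =
      fun j => cls (Function.update ts i t j) := by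
  funext j
  by_cases hj : j = i
  · subst hj; simp
  · simp [hj]

/-- The operation `μ` on classes of expressions, as a multilinear map. -/
noncomputable def opMul {n : ℕ} (μ : P.obj n) :
    MultilinearMap R (fun _ : Fin n => Carrier M) (Carrier M) :=
  MultilinearMap.mk' (opFun μ)
    (fun q i x y => by
      induction q using ind_pi with | _ ts
      induction x using ind with | _ x
      induction y using ind with | _ y
      have := sound (Rel.arg_add μ ts i x y)
      rw [← opFun_cls, ← update_cls] at this
      refine this.trans ?_
      rw [update_cls, update_cls, opFun_cls, opFun_cls]
      rfl)
    (fun q i r x => by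
      induction q using ind_pi with | _ ts
      induction x using ind with | _ x
      have := sound (Rel.arg_smul μ ts i r x)
      rw [← opFun_cls, ← update_cls] at this
      refine this.trans ?_
      rw [update_cls, opFun_cls]
      rfl)

theorem opMul_cls {n : ℕ} (μ : P.obj n) (ts : Fin n → Pre M) :
    opMul μ (fun j => cls (ts j)) = cls (.op μ ts) := opFun_cls μ ts

theorem graft_cls {m n k : ℕ} (h : m + n = k + 1) (i : Fin m) (ν : P.obj n) (ts : Fin k → Pre M) :
    graft h i (fun b => opMul ν b) (fun j => cls (ts j)) =
      fun j => cls (graft h i (fun b => .op ν b) ts j) := by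
  funext j
  unfold graft
  split_ifs
  · exact opMul_cls _ _
  · rfl

end FreeAlg

open FreeAlg in
/-- The free `A`-algebra `Free_A(M)` over the `A`-module `M`: the `P`-algebra generated by the
elements of `A` and of `M`, subject to the relations that make `A → Free_A(M)` a morphism of
`P`-algebras and `M → Free_A(M)` a morphism of `A`-modules. -/
noncomputable def freeAlg {A : Alg P} (M : Mod A) : Alg P where
  carrier := FreeAlg.Carrier M
  eval {n} :=
    { toFun := fun μ => opMul μ
      map_add' := fun μ ν => MultilinearMap.ext fun q => by
        induction q using ind_pi with | _ ts
        rw [add_apply, opMul_cls, opMul_cls, opMul_cls]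
        exact sound (.op_add _ _ _)
      map_smul' := fun r μ => MultilinearMap.ext fun q => by
        induction q using ind_pi with | _ ts
        rw [RingHom.id_apply, smul_apply, opMul_cls, opMul_cls]
        exact sound (.op_smul _ _ _) }
  eval_perm σ μ q := by
    induction q using ind_pi with | _ ts
    exact (opMul_cls _ _).trans ((sound (.op_perm σ μ ts)).trans (opMul_cls _ _).symm)
  eval_one q := by
    induction q using ind_pi with | _ ts
    exact (opMul_cls _ _).trans (sound (.op_one ts))
  eval_circ h i μ ν q := by
    induction q using ind_pi with | _ ts
    refine (opMul_cls _ _).trans ((sound (.op_circ h i μ ν ts)).trans ?_)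
    refine Eq.trans ?_ (congrArg (opMul μ) (graft_cls h i ν ts)).symm
    exact (opMul_cls _ _).symm

open FreeAlg in
/-- The `A`-algebra structure `A → Free_A(M)`. -/
noncomputable def freeUnit {A : Alg P} (M : Mod A) : A ⟶ freeAlg M where
  lin :=
    { toFun := fun a => (cls (Pre.base a) : FreeAlg.Carrier M)
      map_add' := fun _ _ => sound (.base_add _ _)
      map_smul' := fun _ _ => sound (.base_smul _ _) }
  map_eval μ a := (sound (.base_eval μ a)).trans (opMul_cls μ _).symm

open FreeAlg in
/-- The inclusion `M → Free_A(M)`, a morphism of `A`-modules. -/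
noncomputable def freeGen {A : Alg P} (M : Mod A) : Mod.Hom M (restrict (freeUnit M)) where
  lin :=
    { toFun := fun x => (cls (Pre.gen x) : FreeAlg.Carrier M)
      map_add' := fun _ _ => sound (.gen_add _ _)
      map_smul' := fun _ _ => sound (.gen_smul _ _) }
  map_act {n} μ a x := by
    refine (sound (.gen_act μ a x)).trans ?_
    refine (opMul_cls μ _).symm.trans (congrArg (opMul μ) (funext fun j => ?_))
    exact map_snoc cls (fun j => Pre.base (a j)) (Pre.gen x) j

namespace FreeAlg

variable {A B : Alg P} {M : Mod A} (u : A ⟶ B) (g : Mod.Hom M (restrict u))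

/-- The value of an expression in the `A`-algebra `u : A → B`, when the elements of `M` are
interpreted through the `A`-linear morphism `g : M → B`. -/
def interp : Pre M → B
  | .base a => u a
  | .gen x => g.lin x
  | .op μ ts => B.eval μ (fun j => interp (ts j))
  | .zero => 0
  | .add s t => interp s + interp t
  | .smul r t => r • interp t

theorem interp_update {n : ℕ} (ts : Fin n → Pre M) (i : Fin n) (t : Pre M) :
    (fun j => interp u g (Function.update ts i t j)) =
      Function.update (fun j => interp u g (ts j)) i (interp u g t) := by
  funext j
  by_cases hj : j = i
  · subst hj; simp
  · simp [hj]

theorem interp_rel {s t : Pre M} (h : Rel M s t) : interp u g s = interp u g t := by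
  induction h with
  | refl => rfl
  | symm _ ih => exact ih.symm
  | trans _ _ ih ih' => exact ih.trans ih'
  | op_congr μ _ ih => simp only [interp, ih]
  | add_congr _ _ ih ih' => simp only [interp, ih, ih']
  | smul_congr r _ ih => simp only [interp, ih]
  | add_assoc => exact add_assoc _ _ _
  | add_comm => exact add_comm _ _
  | zero_add => exact zero_add _
  | one_smul => exact one_smul _ _
  | mul_smul => exact mul_smul _ _ _
  | smul_add => exact smul_add _ _ _
  | add_smul => exact add_smul _ _ _
  | zero_smul => exact zero_smul _ _
  | op_add => simp [interp]
  | op_smul => simp [interp]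
  | arg_add => simp [interp, interp_update]
  | arg_smul => simp [interp, interp_update]
  | op_perm => exact B.eval_perm _ _ _
  | op_one => exact B.eval_one _
  | op_circ h i μ ν ts =>
    refine (B.eval_circ h i μ ν _).trans (congrArg (B.eval μ) (funext fun j => ?_))
    simp only [graft]
    split_ifs <;> rfl
  | base_add => exact map_add _ _ _
  | base_smul => exact map_smul _ _ _
  | base_eval μ a => exact u.map_eval μ a
  | gen_add => exact map_add _ _ _
  | gen_smul => exact map_smul _ _ _
  | gen_act μ a x =>
    refine (g.map_act μ a x).trans ((restrict_act u μ a _).trans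
      (congrArg (B.eval μ) (funext fun j => ?_)))
    exact (map_snoc (interp u g) (fun j => Pre.base (a j)) (Pre.gen x) j).symm

/-- The morphism `Free_A(M) → B` of `A`-algebras induced by an `A`-linear morphism `M → B`. -/
noncomputable def lift : freeAlg M ⟶ B where
  lin :=
    { toFun := Quotient.lift (interp u g) fun _ _ h => interp_rel u g h
      map_add' := fun x y => by induction x using ind; induction y using ind; rfl
      map_smul' := fun r x => by induction x using ind; rfl }
  map_eval μ q := by
    induction q using ind_pi with | _ ts
    exact congrArg (Quotient.lift (interp u g) fun _ _ h => interp_rel u g h) (opMul_cls μ ts)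

theorem lift_unit (a : A) : lift u g (freeUnit M a) = u a := rfl

theorem lift_gen (x : M) : lift u g ((freeGen M).lin x) = g.lin x := rfl

theorem hom_ext {f f' : freeAlg M ⟶ B} (h : ∀ a, f (freeUnit M a) = f' (freeUnit M a))
    (h' : ∀ x, f ((freeGen M).lin x) = f' ((freeGen M).lin x)) : f = f' := by
  refine Alg.hom_ext fun t => ?_
  induction t using ind with | _ t
  induction t with
  | base a => exact h a
  | gen x => exact h' x
  | op μ ts ih =>
    have e (f : freeAlg M ⟶ B) : f.lin (cls (.op μ ts)) = B.eval μ (fun j => f.lin (cls (ts j))) :=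
      (congrArg f.lin (opMul_cls μ ts).symm).trans (f.map_eval μ _)
    exact (e f).trans ((congrArg (B.eval μ) (funext ih)).trans (e f').symm)
  | zero => exact (map_zero f.lin).trans (map_zero f'.lin).symm
  | add x y ih ih' =>
    exact (map_add f.lin (cls x) (cls y)).trans
      ((congrArg₂ (· + ·) ih ih').trans (map_add f'.lin (cls x) (cls y)).symm)
  | smul r x ih =>
    exact (map_smul f.lin r (cls x)).trans
      ((congrArg (r • ·) ih).trans (map_smul f'.lin r (cls x)).symm)

end FreeAlg

/-- `Free_A(M)` is the free `A`-algebra over `M`: for every `A`-algebra `u : A → B`, the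
morphisms of `A`-algebras `Free_A(M) → B` correspond to the `A`-linear morphisms `M → B`. -/
theorem freeAlg_universal {A B : Alg P} (M : Mod A) (u : A ⟶ B) (g : Mod.Hom M (restrict u)) :
    ∃! f : freeAlg M ⟶ B, freeUnit M ≫ f = u ∧ ∀ x, f ((freeGen M).lin x) = g.lin x :=
  ⟨FreeAlg.lift u g, ⟨rfl, fun _ => rfl⟩, fun _ hf =>
    FreeAlg.hom_ext (fun a => congrArg (fun v : A ⟶ B => v a) hf.1) hf.2⟩

/-! ## The adjoint tangent functor -/

/-- The object `T°(A) = Free_A(Ω_A)`. -/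
noncomputable abbrev adjTangentObj (A : Alg P) : Alg P := freeAlg (kaehler A)

/-- The generator `a` of `T°(A)`, for `a ∈ A`. -/
noncomputable def genA {A : Alg P} (a : A) : adjTangentObj A := freeUnit (kaehler A) a

/-- The generator `d(a)` of `T°(A)`, for `a ∈ A`. -/
noncomputable def genD {A : Alg P} (a : A) : adjTangentObj A :=
  (freeGen (kaehler A)).lin ((kaehlerD A).lin a)

/-- The composite of an `A`-linear morphism `M → B` with a morphism of `A`-algebras `B → C`. -/
def Mod.Hom.push {A B C : Alg P} {M : Mod A} {u : A ⟶ B} (g : Mod.Hom M (restrict u))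
    (f : B ⟶ C) (v : A ⟶ C) (hv : ∀ a, f (u a) = v a) : Mod.Hom M (restrict v) where
  lin := f.lin ∘ₗ (g.lin : M.carrier →ₗ[R] B.carrier)
  map_act {n} μ a x := by
    refine (congrArg f.lin (g.map_act μ a x)).trans ?_
    refine (f.map_eval μ _).trans ((congrArg (C.eval μ) (funext fun j => ?_)).trans
      (restrict_act v μ a _).symm)
    refine (map_snoc f.lin (fun j => u (a j)) (g.lin x) j).trans ?_
    exact congrArg (fun b => Fin.snoc (α := fun _ => C.carrier) b (f.lin (g.lin x)) j)
      (funext fun j => hv (a j))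

theorem adjTangent_hom_ext {A B : Alg P} {f g : adjTangentObj A ⟶ B}
    (h : ∀ a, f (genA a) = g (genA a)) (h' : ∀ a, f (genD a) = g (genD a)) : f = g := by
  refine FreeAlg.hom_ext h fun x => ?_
  have e : (freeGen (kaehler A)).push f (freeUnit (kaehler A) ≫ f) (fun _ => rfl) =
      (freeGen (kaehler A)).push g (freeUnit (kaehler A) ≫ f) (fun a => (h a).symm) :=
    Kaehler.hom_ext h'
  exact congrArg (fun k => k.lin x) e

/-- The `A`-module structure of `B` through `u : A → B`, with the distinguished input in an
arbitrary place. -/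
theorem restrict_actAt {A B : Alg P} (u : A ⟶ B) {n : ℕ} (μ : P.obj n) (i : Fin n)
    (a : Fin n → A) (b : B) : (restrict u).actAt μ i a b =
      B.eval μ (fun j => if j = i then b else u (a j)) := by
  cases n with
  | zero => exact i.elim0
  | succ n =>
    refine (restrict_act u _ _ b).trans ((B.eval_perm _ μ _).trans
      (congrArg (B.eval μ) (funext fun j => ?_)))
    rcases Fin.eq_self_or_eq_succAbove i j with rfl | ⟨j, rfl⟩
    · have : (cycleLast j).symm j = Fin.last n := by
        rw [Equiv.symm_apply_eq]; simp [cycleLast]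
      rw [this, Fin.snoc_last, if_pos rfl]
    · have : (cycleLast i).symm (i.succAbove j) = j.castSucc := by
        rw [Equiv.symm_apply_eq]; simp [cycleLast]
      rw [this, Fin.snoc_castSucc, if_neg (Fin.succAbove_ne i j)]

/-- The derivation `A → T°(B)`, `a ↦ d(f(a))`, for a morphism `f : A → B`. -/
noncomputable def derMap {A B : Alg P} (f : A ⟶ B) :
    Der A (restrict (f ≫ freeUnit (kaehler B))) where
  lin := ((freeGen (kaehler B)).lin.comp (kaehlerD B).lin).comp f.lin
  leibniz {n} μ a := by
    have e1 := congrArg (fun b => (freeGen (kaehler B)).lin ((kaehlerD B).lin b)) (f.map_eval μ a)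
    refine e1.trans ?_
    have e2 := congrArg (freeGen (kaehler B)).lin ((kaehlerD B).leibniz μ (fun j => f (a j)))
    refine e2.trans ((map_sum _ _ _).trans (Finset.sum_congr rfl fun i _ => ?_))
    refine ((freeGen (kaehler B)).map_actAt μ i _ _).trans ?_
    exact (restrict_actAt _ μ i _ _).trans
      (restrict_actAt (f ≫ freeUnit (kaehler B)) μ i a (genD (f (a i)))).symm

/-- `T°(f) : T°(A) → T°(B)`. -/
noncomputable def adjTangentMap {A B : Alg P} (f : A ⟶ B) : adjTangentObj A ⟶ adjTangentObj B :=
  FreeAlg.lift (f ≫ freeUnit (kaehler B)) (Kaehler.lift (derMap f))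

theorem adjTangentMap_genA {A B : Alg P} (f : A ⟶ B) (a : A) :
    adjTangentMap f (genA a) = genA (f a) := rfl

theorem adjTangentMap_genD {A B : Alg P} (f : A ⟶ B) (a : A) :
    adjTangentMap f (genD a) = genD (f a) := rfl

/-- The functor `T°`, with `T°(A) = Free_A(Ω_A)`, `T°(f)(a) = f(a)`, `T°(f)(d(a)) = d(f(a))`. -/
noncomputable def adjTangent (P : SymmOperad R) : Alg P ⥤ Alg P where
  obj A := freeAlg (kaehler A)
  map f := adjTangentMap f
  map_id _ := adjTangent_hom_ext (fun _ => rfl) (fun _ => rfl)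
  map_comp _ _ := adjTangent_hom_ext (fun _ => rfl) (fun _ => rfl)

end SymmOperad

/-! A linear map `g = (g₁, g₂) : A → B ⋉ B` is compatible with the operations exactly when two
conditions hold, one for each component of the operations of `B ⋉ B`. The first component says that
`g₁ : A → B` is a morphism of `P`-algebras. The second one says that `g₂(μ(a₁, …, aₙ)) = ∑ᵢ
μ(g₁(a₁), …, g₂(aᵢ), …, g₁(aₙ))`, which is the Leibniz rule for a derivation of `A` in `B`, viewed
as an `A`-module through `g₁`.

For fixed `g₁`, such derivations are the same as `A`-linear maps `Ω_A → B`, and these are the same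
as morphisms of `A`-algebras `Free_A(Ω_A) → B`. A morphism of `P`-algebras `f : T°(A) → B` makes `B`
an `A`-algebra through its restriction to `A`, so letting `g₁` vary gives the bijection between all
morphisms `T°(A) → B` and all morphisms `A → B ⋉ B`.

In one direction, `sndDer` extracts the derivation, and `Kaehler.lift` and `FreeAlg.lift` extend it
to `sharp g`. In the other, `adjTangentUnit` is a morphism because `d` satisfies the Leibniz rule,
and `flat f` is its composite with `T(f)`. In both, `restrict_actAt` identifies the module
expression `μ(a₁, …, x, …, aₙ)` of the Leibniz rule with an operation of the algebra evaluated with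
`x` in place `i`, as in the definition of `B ⋉ B`.

That the two constructions are inverse and natural is checked on elements of `A` and on the
generators `a`, `d(a)` of `T°(A)`. By `adjTangent_hom_ext`, the generators determine a morphism out
of `T°(A)`. -/

namespace SymmOperad

variable {R : Type u} [CommRing R] {P : SymmOperad R}

/-! ### Derivations and morphisms into a semi-direct product -/

/-- The projection `A ⋉ A → A`, `(a, b) ↦ a`. -/
def semidirectFst (A : Alg P) : A.semidirect ⟶ A where
  lin := LinearMap.fst R A A
  -- The first component of an operation of `A ⋉ A` involves first components only. The second
  -- projection is in general not a morphism: it obeys a Leibniz rule over this one.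
  map_eval μ p := congrArg Prod.fst (A.semidirect_eval μ p)

/-- A morphism `g = (g₁, g₂) : A → B ⋉ B` of `P`-algebras gives the derivation `g₂` of `A` in the
`A`-module underlying the `A`-algebra `g₁ : A → B`. -/
def sndDer {A B : Alg P} (g : A ⟶ B.semidirect) : Der A (restrict (g ≫ semidirectFst B)) where
  lin := (LinearMap.snd R B B).comp g.lin
  leibniz μ a := by
    -- The second component of the compatibility of `g` with `μ` is already the Leibniz rule,
    -- written with operations of `B`.
    have e : (g (A.eval μ a)).2 =
        ∑ i, B.eval μ (fun j => if j = i then (g (a j)).2 else (g (a j)).1) :=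
      congrArg Prod.snd ((g.map_eval μ a).trans (B.semidirect_eval μ _))
    refine e.trans (Finset.sum_congr rfl fun i _ => ?_)
    -- The `i`-th term of the Leibniz rule is a module action whose distinguished input was moved to
    -- the last place; here it returns to place `i`, so that both sides become `μ` evaluated in `B`.
    refine Eq.trans ?_ (restrict_actAt (g ≫ semidirectFst B) μ i a (g (a i)).2).symm
    refine congrArg (B.eval μ) (funext fun j => ?_)
    -- In place `i` both tuples contain `g₂(aᵢ)`; in every other place the entry `g₁(aⱼ)` is the
    -- value of the structure morphism `g ≫ semidirectFst B`.
    by_cases hj : j = i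
    · subst hj; rw [if_pos rfl, if_pos rfl]
    · rw [if_neg hj, if_neg hj]; rfl

/-- The morphism `A → T°(A) ⋉ T°(A)`, `a ↦ (a, d(a))`. -/
noncomputable def adjTangentUnit (A : Alg P) : A ⟶ (adjTangentObj A).semidirect where
  -- `derMap (𝟙 A)` is the universal derivation followed by `Ω_A → T°(A)`; it takes its values in
  -- the algebra itself, where the Leibniz rule can be compared with the operations of `T°(A) ⋉
  -- T°(A)`.
  lin := LinearMap.prod (freeUnit (kaehler A)).lin (derMap (𝟙 A)).lin
  map_eval μ a := by
    refine Eq.trans ?_ ((adjTangentObj A).semidirect_eval μ _).symm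
    refine Prod.ext ((freeUnit (kaehler A)).map_eval μ a) ?_
    -- The second components agree by the Leibniz rule for `d`, term by term.
    refine ((derMap (𝟙 A)).leibniz μ a).trans (Finset.sum_congr rfl fun i _ => ?_)
    refine (restrict_actAt (𝟙 A ≫ freeUnit (kaehler A)) μ i a (genD (a i))).trans
      (congrArg ((adjTangentObj A).eval μ) (funext fun j => ?_))
    by_cases hj : j = i
    · subst hj; rw [if_pos rfl, if_pos rfl]; rfl
    · rw [if_neg hj, if_neg hj]; rfl

/-! ### The bijection of morphism sets and the adjunction -/

/-- The morphism `f♭ : A → B ⋉ B`, `a ↦ (f(a), f(d(a)))`, for `f : T°(A) → B`. -/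
noncomputable def flat {A B : Alg P} (f : adjTangentObj A ⟶ B) : A ⟶ B.semidirect :=
  adjTangentUnit A ≫ (tangent P).map f

/-- The morphism `g♯ : T°(A) → B`, `a ↦ g₁(a)`, `d(a) ↦ g₂(a)`, for `g = (g₁, g₂) : A → B ⋉ B`. -/
noncomputable def sharp {A B : Alg P} (g : A ⟶ B.semidirect) : adjTangentObj A ⟶ B :=
  -- Two universal properties in succession: the derivation `g₂` factors through `Ω_A`, and the
  -- resulting `A`-linear map extends to the free `A`-algebra, with `B` an `A`-algebra through `g₁`.
  FreeAlg.lift (g ≫ semidirectFst B) (Kaehler.lift (sndDer g))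

/-- The bijection `ALG_P(T°(A), B) ≅ ALG_P(A, B ⋉ B)`. -/
noncomputable def flatEquiv (A B : Alg P) : (adjTangentObj A ⟶ B) ≃ (A ⟶ B.semidirect) where
  toFun := flat
  invFun := sharp
  -- Both `(f♭)♯` and `f` send `a` to `f(a)` and `d(a)` to `f(d(a))`.
  left_inv _ := adjTangent_hom_ext (fun _ => rfl) (fun _ => rfl)
  -- The value of `(g♯)♭` at `a` is the pair of the two components of `g(a)`.
  right_inv _ := Alg.hom_ext fun _ => rfl

/-- The adjunction `T° ⊣ T`. -/
noncomputable def adjTangentAdj (P : SymmOperad R) : adjTangent P ⊣ tangent P :=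
  Adjunction.mkOfHomEquiv
    { homEquiv := flatEquiv
      -- Naturality in `A` is stated for `sharp`, where it compares morphisms out of `T°(A)`: for `h
      -- : A' → A`, both `(h ≫ g)♯` and `T°(h) ≫ g♯` send `a` to `g₁(h(a))` and `d(a)` to
      -- `g₂(h(a))`. Naturality in `B` compares morphisms into a semi-direct product, element by
      -- element.
      homEquiv_naturality_left_symm := fun _ _ =>
        adjTangent_hom_ext (fun _ => rfl) (fun _ => rfl)
      homEquiv_naturality_right := fun _ _ => Alg.hom_ext fun _ => rfl }

/-- An adjunction built from a natural bijection induces that same bijection. This reduces all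
formulas of the theorem to the values of `flat` and `sharp`, which hold by definition. -/
theorem adjTangentAdj_homEquiv (A B : Alg P) :
    (adjTangentAdj P).homEquiv A B = flatEquiv A B := by
  rw [adjTangentAdj, Adjunction.mkOfHomEquiv_homEquiv]

end SymmOperad

/-! ### The formulas for the unit, the counit and the bijection -/

theorem mainTheorem7 {R : Type u} [CommRing R] (P : SymmOperad.{u} R) :
    ∃ adj : SymmOperad.adjTangent P ⊣ SymmOperad.tangent P,
      -- the unit `η_A : A → T°(A) ⋉ T°(A)` is `a ↦ (a, d(a))`
      (∀ (A : P.Alg) (a : A),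
        adj.unit.app A a = (SymmOperad.genA a, SymmOperad.genD a)) ∧
      -- the counit `ε_A : T°(A ⋉ A) → A` is `(a, b) ↦ a`, `d(a, b) ↦ b`
      (∀ (A : P.Alg) (p : A.semidirect),
        adj.counit.app A (SymmOperad.genA p) = p.1 ∧
        adj.counit.app A (SymmOperad.genD p) = p.2) ∧
      -- the bijection `ALG_P(T°(A), A') ≅ ALG_P(A, A' ⋉ A')`
      (∀ (A A' : P.Alg) (f : (SymmOperad.adjTangent P).obj A ⟶ A') (a : A),
        adj.homEquiv A A' f a = (f (SymmOperad.genA a), f (SymmOperad.genD a))) ∧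
      (∀ (A A' : P.Alg) (g : A ⟶ (SymmOperad.tangent P).obj A') (a : A),
        (adj.homEquiv A A').symm g (SymmOperad.genA a) = (g a).1 ∧
        (adj.homEquiv A A').symm g (SymmOperad.genD a) = (g a).2) := by
  refine ⟨SymmOperad.adjTangentAdj P, fun A a => ?_, fun A p => ?_, fun A A' f a => ?_,
    fun A A' g a => ?_⟩
  -- The unit at `A` is `f♭` for `f` the identity of `T°(A)`.
  · rw [← Adjunction.homEquiv_id, SymmOperad.adjTangentAdj_homEquiv]
    rfl
  -- The counit at `A` is `g♯` for `g` the identity of `A ⋉ A`, whose components are the two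
  -- projections.
  · rw [← Adjunction.homEquiv_symm_id, SymmOperad.adjTangentAdj_homEquiv]
    exact ⟨rfl, rfl⟩
  · rw [SymmOperad.adjTangentAdj_homEquiv]
    rfl
  · rw [SymmOperad.adjTangentAdj_homEquiv]
    exact ⟨rfl, rfl⟩
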